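/- A standard quantum circuit on $n$ qubits is a finite sequence of gates, each of which is either an arbitrary single-qubit unitary on one of the qubits or a CNOT gate on an ordered pair of distinct qubits; its size is its total number of gates, and no ancillary qubits are used. For a graph $G$ on the vertex set of the $n$ qubits, the circuit is under $G$ constraint if every CNOT gate in it acts on two qubits that are adjacent in $G$. A circuit $C$ prepares an $n$-qubit state $|\psi\rangle$ (a unit vector in $\mathbb{C}^{2^n}$) if $C|0^n\rangle=|\psi\rangle$. **Theorem.** (1) There is an absolute constant $K>0$ such that for every $n\ge 1$, every connected graph $G$ on the $n$ qubits and every $n$-qubit state $|\psi\rangle$, there is a standard quantum circuit under $G$ constraint of size at most $K\cdot 2^n$ that prepares $|\psi\rangle$. (2) This is tight: there is an absolute constant $\kappa>0$ such that for every $n\ge 1$ there is an $n$-qubit state $|\psi\rangle$ such that, for every graph $G$ on the $n$ qubits (even the complete graph, that is, without any connectivity constraint), every standard quantum circuit under $G$ constraint that prepares $|\psi\rangle$ has size at least $\kappa\cdot 2^n$. -/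

import Mathlib

/-- Labels of the computational basis states of `n` qubits: bit strings of length `n`. -/
abbrev BitString (n : ℕ) : Type := Fin n → Fin 2

/-- State vectors of `n` qubits: `ℂ^(2^n)` with the Euclidean norm (unit vectors are the states). -/
abbrev StateVector (n : ℕ) : Type := EuclideanSpace ℂ (BitString n)

/-- The basis state `|0^n⟩`. -/
noncomputable def zeroState (n : ℕ) : StateVector n :=
  EuclideanSpace.single (fun _ => 0) 1

/-- The gates of standard quantum circuits on `n` qubits: an arbitrary single-qubit unitary on one
qubit, or a CNOT gate on two distinct qubits (first the control, then the target). -/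
inductive Gate (n : ℕ) : Type where
  | single (q : Fin n) (U : Matrix.unitaryGroup (Fin 2) ℂ) : Gate n
  | cnot (c t : Fin n) (hct : c ≠ t) : Gate n

/-- The `2^n × 2^n` matrix of a gate. A single-qubit gate `U` on `q` acts as `U` on the bit `q` and as
the identity on the others; `CNOT` maps `|x⟩` to the basis state in which the target bit is replaced
by `x c + x t` (addition in `Fin 2`, that is, modulo 2). -/
def Gate.matrix {n : ℕ} : Gate n → Matrix (BitString n) (BitString n) ℂ
  | .single q U => Matrix.of fun y x =>
      if y = Function.update x q (y q) then (U : Matrix (Fin 2) (Fin 2) ℂ) (y q) (x q) else 0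
  | .cnot c t _ => Matrix.of fun y x =>
      if y = Function.update x t (x c + x t) then 1 else 0

/-- A gate is allowed by the constraint graph `G` if it is a single-qubit gate, or a CNOT gate whose
two qubits are adjacent in `G`. -/
def Gate.AllowedBy {n : ℕ} (G : SimpleGraph (Fin n)) : Gate n → Prop
  | .single _ _ => True
  | .cnot c t _ => G.Adj c t

/-- A standard quantum circuit on `n` qubits (without ancillary qubits): a finite sequence of gates,
applied from the head of the list to its end. -/
abbrev QCircuit (n : ℕ) : Type := List (Gate n)

namespace QCircuit

/-- The size of a circuit: its total number of gates (single-qubit and CNOT). -/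
def size {n : ℕ} (C : QCircuit n) : ℕ := List.length C

/-- The `2^n × 2^n` matrix implemented by a circuit. -/
def matrix {n : ℕ} : QCircuit n → Matrix (BitString n) (BitString n) ℂ
  | [] => 1
  | g :: C => matrix C * g.matrix

/-- The circuit is under `G` constraint: every two-qubit gate acts along an edge of `G`. -/
def UnderConstraint {n : ℕ} (G : SimpleGraph (Fin n)) (C : QCircuit n) : Prop :=
  ∀ g ∈ C, Gate.AllowedBy G g

/-- The circuit prepares the vector `v` from `|0^n⟩`. -/
def Prepares {n : ℕ} (C : QCircuit n) (v : StateVector n) : Prop :=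
  Matrix.toEuclideanLin (matrix C) (zeroState n) = v

end QCircuit

/-!
Upper bound. The state is built up one qubit at a time, along a growing set `A` of qubits that is
connected in `G`. When a qubit `t` adjacent to `A` is added, the two amplitudes of the new state over
each assignment of the bits in `A` have the form `r e^{ih} cos θ` and `r e^{-ih} i sin θ` with a
complex `r`. So the new state arises from the state of `A` with amplitudes `r` by Hadamard gates on
`t` and two diagonal operators whose phases are odd in the bit `t` and depend otherwise only on the
bits in `A` (`Preparable.insert`); no diagonal operator on `A` alone is needed, as the common phase
is absorbed into `r`.

It remains to realise such a multiplexed phase by `O(2 ^ |A|)` gates (`Multiplexable`). The controls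
are ordered so that each one is adjacent to `t` or to an earlier control. Splitting the phases into
the parts even and odd in the last control `w` gives two multiplexed phases without `w`, one of which
is conjugated by a ladder of CNOT gates adding to `t` the bit `w` and a function of earlier controls
(`Multiplexable.insert`). The ladder of the `(d + 1)`-st control has at most `2 d + 1` gates, and it
is used only `O(2 ^ (|A| - d))` times: the cost `c` satisfies `c (d + 1) ≤ 2 c d + 2 (2 d + 1)`, hence
`c d ≤ 7 * 2 ^ d - 4 d - 6`. This is why distances in `G` cost only a constant factor.

Lower bound. The matrix entries of a circuit with `s` gates lie in a `ℚ`-algebra generated by `4 s`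
complex numbers, the entries of its one-qubit gates. If the circuit prepares a normalised vector of
`2 ^ n` algebraically independent numbers, then these numbers and the norm show that
`2 ^ n ≤ 4 s + 1` (`exists_state_size_ge`).
-/

open Function

/-! ### The action of circuits on amplitude functions -/

namespace QCircuit

/-- The action of a circuit on families of amplitudes indexed by the basis states. -/
noncomputable def act {n : ℕ} (C : QCircuit n) (φ : BitString n → ℂ) : BitString n → ℂ :=
  (matrix C).mulVec φ

variable {n : ℕ}

lemma act_nil (φ : BitString n → ℂ) : act [] φ = φ := by
  simp [act, matrix]

lemma act_append (C D : QCircuit n) (φ : BitString n → ℂ) :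
    act (C ++ D) φ = act D (act C φ) := by
  induction C generalizing φ with
  | nil => simp [act_nil]
  | cons g C ih =>
    have h (E : QCircuit n) : act (g :: E) φ = act E (g.matrix.mulVec φ) := by
      simp [act, matrix, Matrix.mulVec_mulVec]
    rw [List.cons_append, h, h, ih]

lemma act_single (q : Fin n) (U : Matrix.unitaryGroup (Fin 2) ℂ) (φ : BitString n → ℂ)
    (y : BitString n) :
    act [Gate.single q U] φ y =
      ∑ b, (U : Matrix (Fin 2) (Fin 2) ℂ) (y q) b * φ (update y q b) := by
  simp only [act, matrix, one_mul, Gate.matrix, Matrix.mulVec, dotProduct, Matrix.of_apply,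
    ite_mul, zero_mul]
  rw [← Finset.sum_filter]
  refine Finset.sum_nbij' (fun x => x q) (fun b => update y q b) ?_ ?_ ?_ ?_ ?_
  · simp
  · simp
  · intro x hx
    rw [(Finset.mem_filter.mp hx).2]
    simp
  · simp
  · intro x hx
    have h : update y q (x q) = x := by
      conv_lhs => rw [(Finset.mem_filter.mp hx).2]
      simp
    rw [h]

lemma act_cnot (c t : Fin n) (hct : c ≠ t) (φ : BitString n → ℂ) (y : BitString n) :
    act [Gate.cnot c t hct] φ y = φ (update y t (y t + y c)) := by
  have two (a : Fin 2) : a + a = 0 := by fin_cases a <;> rfl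
  simp only [act, matrix, one_mul, Gate.matrix, Matrix.mulVec, dotProduct, Matrix.of_apply,
    ite_mul, zero_mul]
  rw [Finset.sum_eq_single (update y t (y t + y c))]
  · rw [if_pos]
    simp [hct, add_comm (y t), ← add_assoc, two]
  · intro x _ hx
    refine if_neg fun h => hx ?_
    rw [h]
    simp [hct, add_comm (x c), add_assoc, two]
  · simp

end QCircuit

/-- The operator `T` on families of amplitudes is realised by a circuit under `G` constraint of size
at most `s`. -/
def Implementable {n : ℕ} (G : SimpleGraph (Fin n)) (s : ℕ)
    (T : (BitString n → ℂ) → BitString n → ℂ) : Prop :=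
  ∃ C : QCircuit n, QCircuit.UnderConstraint G C ∧ C.size ≤ s ∧ ∀ φ, C.act φ = T φ

section Implementable

variable {n : ℕ} {G : SimpleGraph (Fin n)}

lemma Implementable.mono {s s' : ℕ} {T : (BitString n → ℂ) → BitString n → ℂ}
    (h : Implementable G s T) (hs : s ≤ s') : Implementable G s' T := by
  obtain ⟨C, hC, hsize, hT⟩ := h
  exact ⟨C, hC, hsize.trans hs, hT⟩

lemma Implementable.comp {s s' : ℕ} {T T' : (BitString n → ℂ) → BitString n → ℂ}
    (h' : Implementable G s' T') (h : Implementable G s T) :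
    Implementable G (s + s') (T' ∘ T) := by
  obtain ⟨C, hC, hsize, hT⟩ := h
  obtain ⟨C', hC', hsize', hT'⟩ := h'
  refine ⟨C ++ C', ?_, ?_, fun φ => ?_⟩
  · intro g hg
    exact (List.mem_append.mp hg).elim (hC g) (hC' g)
  · simp only [QCircuit.size, List.length_append] at *
    omega
  · rw [QCircuit.act_append, hT, hT', comp_apply]

lemma implementable_single (G : SimpleGraph (Fin n)) (q : Fin n)
    (U : Matrix.unitaryGroup (Fin 2) ℂ) :
    Implementable G 1 fun φ y =>
      ∑ b, (U : Matrix (Fin 2) (Fin 2) ℂ) (y q) b * φ (update y q b) :=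
  ⟨[Gate.single q U], by simp [QCircuit.UnderConstraint, Gate.AllowedBy], by simp [QCircuit.size],
    fun φ => funext fun y => QCircuit.act_single q U φ y⟩

/-- The map on bit strings that adds `ℓ y` to the bit `t` of `y`. -/
def addAt (t : Fin n) (ℓ : BitString n → Fin 2) (y : BitString n) : BitString n :=
  update y t (y t + ℓ y)

/-- The diagonal operator with phases `exp (i f)`. -/
noncomputable def phaseOp (f : BitString n → ℝ) (φ : BitString n → ℂ) : BitString n → ℂ :=
  fun y => Complex.exp (f y * Complex.I) * φ y

/-- Precomposition of the amplitudes with a map of bit strings; for an involution `W` this is the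
permutation operator `|x⟩ ↦ |W x⟩`. -/
def permOp (W : BitString n → BitString n) (φ : BitString n → ℂ) : BitString n → ℂ :=
  fun y => φ (W y)

lemma implementable_cnot {c t : Fin n} (h : G.Adj c t) :
    Implementable G 1 (permOp (addAt t fun y => y c)) :=
  ⟨[Gate.cnot c t h.ne], by simpa [QCircuit.UnderConstraint, Gate.AllowedBy] using h,
    by simp [QCircuit.size], fun φ => funext fun y => QCircuit.act_cnot c t h.ne φ y⟩

lemma diagonal_mem_unitaryGroup {d : Fin 2 → ℂ} (hd : ∀ b, ‖d b‖ = 1) :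
    Matrix.diagonal d ∈ Matrix.unitaryGroup (Fin 2) ℂ := by
  rw [Matrix.mem_unitaryGroup_iff, Matrix.star_eq_conjTranspose, Matrix.diagonal_conjTranspose,
    Matrix.diagonal_mul_diagonal, ← Matrix.diagonal_one]
  congr 1
  ext b
  simp [Complex.mul_conj, Complex.normSq_eq_norm_sq, hd]

lemma implementable_diagonal (G : SimpleGraph (Fin n)) (q : Fin n) {d : Fin 2 → ℂ}
    (hd : ∀ b, ‖d b‖ = 1) : Implementable G 1 fun φ y => d (y q) * φ y := by
  convert implementable_single G q ⟨_, diagonal_mem_unitaryGroup hd⟩ using 3 with φ y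
  simp [Matrix.diagonal_apply]

/-- The Hadamard gate on the qubit `t`. -/
lemma implementable_hadamard (G : SimpleGraph (Fin n)) (t : Fin n) :
    Implementable G 1 fun φ y =>
      (√2 : ℂ)⁻¹ * (φ (update y t 0) + (if y t = 0 then 1 else -1) * φ (update y t 1)) := by
  have hmem : (√2 : ℂ)⁻¹ • !![1, 1; 1, -1] ∈ Matrix.unitaryGroup (Fin 2) ℂ := by
    have h2 : (√2 : ℂ)⁻¹ * (√2 : ℂ)⁻¹ = 2⁻¹ := by
      rw [← mul_inv, ← Complex.ofReal_mul, Real.mul_self_sqrt (by norm_num)]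
      norm_num
    rw [Matrix.mem_unitaryGroup_iff]
    ext i j
    fin_cases i <;> fin_cases j <;>
      simp [Matrix.mul_apply, Fin.sum_univ_two, Matrix.star_apply, h2] <;> norm_num
  convert implementable_single G t ⟨_, hmem⟩ using 3 with φ y
  obtain h | h : y t = 0 ∨ y t = 1 := by omega
  all_goals simp [h, Fin.sum_univ_two]; ring

end Implementable

/-! ### Multiplexed phases -/

section Multiplexed

variable {n : ℕ} {G : SimpleGraph (Fin n)}

lemma fin_two_add_self (a : Fin 2) : a + a = 0 := by
  fin_cases a <;> rfl

lemma fin_two_add_one_of_ne {a b : Fin 2} (h : a ≠ b) : a + 1 = b := by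
  revert a b
  decide

lemma addAt_addAt {t : Fin n} {ℓ : BitString n → Fin 2} (hℓ : DependsOn ℓ {t}ᶜ)
    (y : BitString n) : addAt t ℓ (addAt t ℓ y) = y := by
  have h : ℓ (addAt t ℓ y) = ℓ y := hℓ fun i hi => by
    simp only [Set.mem_compl_iff, Set.mem_singleton_iff] at hi
    simp [addAt, hi]
  rw [addAt, h]
  simp [addAt, add_assoc, fin_two_add_self]

lemma addAt_one_addAt_one (t : Fin n) (y : BitString n) :
    addAt t (fun _ => 1) (addAt t (fun _ => 1) y) = y :=
  addAt_addAt (fun _ _ _ => rfl) y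

/-- A function that does not change when the bit `w` is flipped does not depend on that bit. -/
lemma DependsOn.of_flip_invariant {α : Type*} {F : BitString n → α} {S : Set (Fin n)} {w : Fin n}
    (hF : DependsOn F (insert w S)) (hflip : ∀ y, F (addAt w (fun _ => 1) y) = F y) :
    DependsOn F S := by
  intro x y hxy
  by_cases hw : x w = y w
  · refine hF fun i hi => ?_
    rcases hi with rfl | hi
    exacts [hw, hxy i hi]
  · rw [← hflip x]
    refine hF fun i hi => ?_
    by_cases hiw : i = w
    · subst hiw
      simp only [addAt, update_self]
      exact fin_two_add_one_of_ne hw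
    · simpa [addAt, hiw] using hxy i (hi.resolve_left hiw)

/-- The two facts about a target qubit `t` and a set `D` of controls that are carried along while
`D` grows. `D` is within reach of `t`: for each control `u`, a ladder of few CNOT gates adds to the
target the bit `u`, up to a function of the other controls. Moreover, every diagonal operator whose
phases depend only on the bits in `D` and on the target, and change sign with the target bit, is
implementable by `O(2 ^ |D|)` gates. -/
structure Multiplexable (G : SimpleGraph (Fin n)) (t : Fin n) (D : Finset (Fin n)) : Prop where
  notMem : t ∉ D
  ladder : ∀ u ∈ D, ∃ g : BitString n → Fin 2, DependsOn g (D \ {u} : Set (Fin n)) ∧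
    Implementable G (2 * D.card - 1) (permOp (addAt t fun y => y u + g y))
  phase : ∀ f : BitString n → ℝ, DependsOn f (insert t D : Set (Fin n)) →
    (∀ y, f (addAt t (fun _ => 1) y) = - f y) →
    Implementable G (7 * 2 ^ D.card - 4 * D.card - 6) (phaseOp f)

lemma multiplexable_empty (G : SimpleGraph (Fin n)) (t : Fin n) : Multiplexable G t ∅ where
  notMem := by simp
  ladder := by simp
  phase := by
    intro f hf _
    have hphase : phaseOp f = fun φ y => Complex.exp (f (fun _ => y t) * Complex.I) * φ y := by
      funext φ y
      rw [phaseOp.eq_1, hf (x := y) (y := fun _ => y t) (by simp)]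
    rw [hphase]
    exact implementable_diagonal G t (d := fun b => Complex.exp (f (fun _ => b) * Complex.I))
      fun b => Complex.norm_exp_ofReal_mul_I _

/-- A new control `w` adjacent to `t` is added to the target by a single CNOT gate; if `w` is
adjacent to a control `u`, the ladder of `u` is conjugated by a CNOT gate from `w` to `u`. -/
lemma Multiplexable.exists_ladder {t w u : Fin n} {D : Finset (Fin n)} (h : Multiplexable G t D)
    (hwt : w ≠ t) (hu : u ∈ insert t D) (hadj : G.Adj w u) :
    ∃ g : BitString n → Fin 2, DependsOn g (D : Set (Fin n)) ∧
      Implementable G (2 * D.card + 1) (permOp (addAt t fun y => y w + g y)) := by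
  rcases Finset.mem_insert.mp hu with rfl | hu
  · exact ⟨fun _ => 0, fun _ _ _ => rfl, by
      simpa using (implementable_cnot hadj).mono (by omega)⟩
  · obtain ⟨g, hg, hI⟩ := h.ladder u hu
    have hut : u ≠ t := fun e => h.notMem (e ▸ hu)
    have hwu : w ≠ u := hadj.ne
    have hcard : 0 < D.card := Finset.card_pos.mpr ⟨u, hu⟩
    refine ⟨fun y => y u + g y, ?_, ?_⟩
    · intro x y hxy
      dsimp only
      rw [hxy u hu, hg fun i hi => hxy i hi.1]
    · have hcx := implementable_cnot hadj
      refine Implementable.mono (s := 1 + (2 * D.card - 1) + 1) ?_ (by omega)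
      convert hcx.comp (hI.comp hcx) using 1
      funext φ y
      have hgy : g (addAt u (fun y => y w) y) = g y := hg fun i hi => by
        have : i ≠ u := hi.2
        simp [addAt, this]
      simp only [comp_apply, permOp]
      rw [addAt.eq_1 t (fun y => y u + g y), hgy]
      congr 1
      funext i
      by_cases hit : i = t
      · subst hit
        simp [addAt, hut.symm]
        ac_rfl
      · by_cases hiu : i = u
        · subst hiu
          simp [addAt, hut, hwt, hwu, add_assoc, fin_two_add_self]
        · simp [addAt, hit, hiu]

/-- Splitting the phases into their even and odd parts with respect to the new control bit `w`
reduces to `D`: the even part does not depend on `w`, and conjugation by the ladder of `w` turns the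
odd part into phases which do not depend on `w`. -/
lemma Multiplexable.insert {t w u : Fin n} {D : Finset (Fin n)} (h : Multiplexable G t D)
    (hwt : w ≠ t) (hwD : w ∉ D) (hu : u ∈ insert t D) (hadj : G.Adj w u) :
    Multiplexable G t (insert w D) := by
  obtain ⟨g, hg, hI⟩ := h.exists_ladder hwt hu hadj
  have hcard : (Insert.insert w D).card = D.card + 1 := Finset.card_insert_of_notMem hwD
  refine ⟨by simp [hwt.symm, h.notMem], ?_, ?_⟩
  · intro v hv
    rw [hcard]
    rcases Finset.mem_insert.mp hv with rfl | hv
    · refine ⟨g, hg.mono ?_, hI.mono (by omega)⟩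
      intro i hi
      exact ⟨by simp [Finset.mem_coe.mp hi], fun e => hwD (e ▸ hi)⟩
    · obtain ⟨g', hg', hI'⟩ := h.ladder v hv
      refine ⟨g', hg'.mono ?_, hI'.mono (by omega)⟩
      exact Set.sdiff_subset_sdiff_left (by simp)
  · intro f hf hodd
    rw [hcard]
    set flipw : BitString n → BitString n := addAt w fun _ => 1 with hflipw
    set flipt : BitString n → BitString n := addAt t fun _ => 1 with hflipt
    set W : BitString n → BitString n := addAt t fun y => y w + g y with hW
    have hgflip (y : BitString n) : g (flipw y) = g y := hg fun i hi => by
      have : i ≠ w := fun e => hwD (e ▸ hi)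
      simp [hflipw, addAt, this]
    have hcomm (y : BitString n) : flipw (flipt y) = flipt (flipw y) := by
      funext i
      by_cases hit : i = t
      · subst hit; simp [hflipw, hflipt, addAt, hwt.symm]
      · by_cases hiw : i = w
        · subst hiw; simp [hflipw, hflipt, addAt, hwt]
        · simp [hflipw, hflipt, addAt, hit, hiw]
    -- The ladder adds the bit `w` to the target, so flipping `w` beforehand flips both afterwards.
    have hWflip (y : BitString n) : W (flipw y) = flipw (flipt (W y)) := by
      funext i
      by_cases hit : i = t
      · subst hit
        rw [hW, addAt, hgflip]
        simp [hflipw, hflipt, addAt, hwt.symm]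
        ac_rfl
      · by_cases hiw : i = w
        · subst hiw; simp [hW, hflipw, hflipt, addAt, hwt]
        · simp [hW, hflipw, hflipt, addAt, hit, hiw]
    have hWflipt (y : BitString n) : W (flipt y) = flipt (W y) := by
      have hgt : g (flipt y) = g y := hg fun i hi => by
        have : i ≠ t := fun e => h.notMem (e ▸ hi)
        simp [hflipt, addAt, this]
      funext i
      by_cases hit : i = t
      · subst hit
        rw [hW, addAt, hgt]
        simp [hflipt, addAt, hwt]
        ac_rfl
      · simp [hW, hflipt, addAt, hit]
    have hWW (y : BitString n) : W (W y) = y := by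
      refine addAt_addAt ?_ y
      intro x y hxy
      dsimp only
      rw [hxy w hwt, hg fun i hi => hxy i fun e => h.notMem (e ▸ hi)]
    set feven : BitString n → ℝ := fun y => (f y + f (flipw y)) / 2 with hfeven
    set fodd : BitString n → ℝ := fun y => (f y - f (flipw y)) / 2 with hfodd
    have hset : (Insert.insert t (↑(Insert.insert w D) : Set (Fin n))) =
        Insert.insert w (Insert.insert t (D : Set (Fin n))) := by
      rw [Finset.coe_insert, Set.insert_comm]
    rw [hset] at hf
    have hfflip {x y : BitString n}
        (hxy : ∀ i ∈ Insert.insert w (Insert.insert t (D : Set (Fin n))), x i = y i) :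
        f (flipw x) = f (flipw y) := by
      refine hf fun i hi => ?_
      by_cases hiw : i = w
      · subst hiw; simp [hflipw, addAt, hxy i hi]
      · simpa [hflipw, addAt, hiw] using hxy i hi
    have hoddflip (y : BitString n) : fodd (flipw y) = - fodd y := by
      simp only [hfodd, hflipw, addAt_one_addAt_one]
      ring
    have hoddflipt (y : BitString n) : fodd (flipt y) = - fodd y := by
      simp only [hfodd]
      rw [hcomm, hodd, hodd]
      ring
    have hE : Implementable G (7 * 2 ^ D.card - 4 * D.card - 6) (phaseOp feven) := by
      refine h.phase _ (DependsOn.of_flip_invariant (w := w) ?_ ?_) ?_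
      · intro x y hxy
        simp only [hfeven]
        rw [hf hxy, hfflip hxy]
      · intro y
        simp only [hfeven, hflipw, addAt_one_addAt_one]
        ring
      · intro y
        simp only [hfeven]
        change (f (flipt y) + f (flipw (flipt y))) / 2 = _
        rw [hcomm, hodd, hodd]
        ring
    have hO : Implementable G (7 * 2 ^ D.card - 4 * D.card - 6) (phaseOp fun y => fodd (W y)) := by
      refine h.phase _ (DependsOn.of_flip_invariant (w := w) ?_ ?_) ?_
      · intro x y hxy
        have hWxy : ∀ i ∈ Insert.insert w (Insert.insert t (D : Set (Fin n))), W x i = W y i := by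
          intro i hi
          by_cases hit : i = t
          · subst hit
            simp only [hW, addAt, update_self]
            rw [hxy i hi, hxy w (by simp), hg fun j hj => hxy j (by simp [Finset.mem_coe.mp hj])]
          · simpa [hW, addAt, hit] using hxy i hi
        simp only [hfodd]
        rw [hf hWxy, hfflip hWxy]
      · intro y
        change fodd (W (flipw y)) = _
        rw [hWflip, hoddflip, hoddflipt, neg_neg]
      · intro y
        change fodd (W (flipt y)) = _
        rw [hWflipt, hoddflipt]
    refine Implementable.mono (s := (2 * D.card + 1) + (7 * 2 ^ D.card - 4 * D.card - 6) +
      (2 * D.card + 1) + (7 * 2 ^ D.card - 4 * D.card - 6)) ?_ ?_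
    · convert hE.comp (hI.comp (hO.comp hI)) using 1
      funext φ y
      simp only [comp_apply, phaseOp, permOp]
      rw [hWW, ← mul_assoc, ← Complex.exp_add, ← add_mul, ← Complex.ofReal_add]
      congr 4
      simp only [hfeven, hfodd]
      ring
    · have : D.card + 1 ≤ 2 ^ D.card := Nat.lt_two_pow_self
      rw [pow_succ]
      omega

end Multiplexed

/-! ### Growing connected sets of qubits -/

section Growth

variable {n : ℕ} {G : SimpleGraph (Fin n)}

/-- The set `A` induces a preconnected subgraph of `G`: every nonempty proper subset of `A` has an
edge to the rest of `A`. -/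
def EdgeConnected (G : SimpleGraph (Fin n)) (A : Finset (Fin n)) : Prop :=
  ∀ B ⊆ A, B.Nonempty → B ≠ A → ∃ u ∈ B, ∃ w ∈ A, w ∉ B ∧ G.Adj u w

lemma edgeConnected_univ (hG : G.Connected) : EdgeConnected G Finset.univ := by
  intro B _ ⟨a, ha⟩ hB
  obtain ⟨b, hb⟩ : ∃ b, b ∉ B := by
    by_contra! h
    exact hB (Finset.eq_univ_iff_forall.mpr h)
  obtain ⟨p⟩ := hG.preconnected a b
  obtain ⟨d, -, h₁, h₂⟩ := p.exists_boundary_dart (B : Set (Fin n)) ha hb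
  exact ⟨d.fst, h₁, d.snd, Finset.mem_univ _, h₂, d.adj⟩

lemma EdgeConnected.insert {A : Finset (Fin n)} {u w : Fin n} (hA : EdgeConnected G A)
    (hu : u ∈ A) (hw : w ∉ A) (hadj : G.Adj u w) : EdgeConnected G (insert w A) := by
  intro B hBA hB hne
  by_cases h : (B ∩ A).Nonempty
  · by_cases hsub : A ⊆ B
    · have hwB : w ∉ B := fun hwB =>
        hne (hBA.antisymm (Finset.insert_subset hwB hsub))
      exact ⟨u, hsub hu, w, Finset.mem_insert_self _ _, hwB, hadj⟩
    · obtain ⟨x, hx, y, hy, hyB, hxy⟩ := hA (B ∩ A) Finset.inter_subset_right h fun e =>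
        hsub (e ▸ Finset.inter_subset_left)
      exact ⟨x, (Finset.mem_inter.mp hx).1, y, Finset.mem_insert_of_mem hy,
        fun hB => hyB (Finset.mem_inter.mpr ⟨hB, hy⟩), hxy⟩
  · have hBw : ∀ x ∈ B, x = w := fun x hx =>
      (Finset.mem_insert.mp (hBA hx)).resolve_right fun hxA => h ⟨x, Finset.mem_inter.mpr ⟨hx, hxA⟩⟩
    obtain ⟨x, hx⟩ := hB
    have hwB : w ∈ B := hBw x hx ▸ hx
    exact ⟨w, hwB, u, Finset.mem_insert_of_mem hu, fun huB => hw (hBw u huB ▸ hu), hadj.symm⟩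

lemma EdgeConnected.exists_insert (hG : G.Connected) {A : Finset (Fin n)}
    (hA : EdgeConnected G A) (hne : A ≠ Finset.univ) :
    ∃ t, t ∉ A ∧ EdgeConnected G (Insert.insert t A) := by
  rcases A.eq_empty_or_nonempty with rfl | h
  · obtain ⟨t⟩ := hG.nonempty
    refine ⟨t, by simp, fun B hB hBne hBt => ?_⟩
    exact absurd ((Finset.subset_singleton_iff.mp (by simpa using hB)).resolve_left hBne.ne_empty)
      (by simpa using hBt)
  · obtain ⟨u, hu, w, -, hw, hadj⟩ := edgeConnected_univ hG A (Finset.subset_univ _) h hne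
    exact ⟨w, hw, hA.insert hu hw hadj⟩

/-- Controls are added in an order in which each one is adjacent to the target or to an earlier
control. -/
lemma EdgeConnected.multiplexable {A : Finset (Fin n)} {t : Fin n} (ht : t ∉ A)
    (hA : EdgeConnected G (Insert.insert t A)) : Multiplexable G t A := by
  have key : ∀ k ≤ A.card, ∃ D ⊆ A, D.card = k ∧ Multiplexable G t D := by
    intro k
    induction k with
    | zero => exact fun _ => ⟨∅, by simp, rfl, multiplexable_empty G t⟩
    | succ k ih =>
      intro hk
      obtain ⟨D, hDA, hcard, hD⟩ := ih (by omega)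
      obtain ⟨u, hu, w, hwA, hwD, hadj⟩ := hA (Insert.insert t D) (Finset.insert_subset_insert t hDA)
        (Finset.insert_nonempty _ _) fun e => by
          have := congrArg Finset.card e
          rw [Finset.card_insert_of_notMem hD.notMem, Finset.card_insert_of_notMem ht] at this
          omega
      rw [Finset.mem_insert, not_or] at hwD
      refine ⟨Insert.insert w D, Finset.insert_subset ?_ hDA, ?_,
        hD.insert hwD.1 hwD.2 hu hadj.symm⟩
      · exact (Finset.mem_insert.mp hwA).resolve_left hwD.1
      · rw [Finset.card_insert_of_notMem hwD.2, hcard]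
  obtain ⟨D, hDA, hcard, hD⟩ := key _ le_rfl
  rwa [Finset.eq_of_subset_of_card_le hDA hcard.ge] at hD

end Growth

/-! ### Preparation of states -/

section Preparation

variable {n : ℕ} {G : SimpleGraph (Fin n)}

/-- Any pair of amplitudes arises from the amplitude `r` of `|0⟩` by a rotation through `θ` and
opposite phases `h` and `-h` of the two amplitudes. -/
lemma exists_amplitude_angles (a b : ℂ) : ∃ (r : ℂ) (θ h : ℝ),
    a = Complex.exp (h * Complex.I) * (Complex.cos θ * r) ∧
    b = Complex.exp (-(h * Complex.I)) * (Complex.sin θ * Complex.I * r) ∧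
    ‖r‖ ^ 2 = ‖a‖ ^ 2 + ‖b‖ ^ 2 := by
  set z : ℂ := ⟨‖a‖, ‖b‖⟩ with hz
  have hzn : ‖z‖ ^ 2 = ‖a‖ ^ 2 + ‖b‖ ^ 2 := by
    rw [← Complex.normSq_eq_norm_sq, Complex.normSq_mk]
    ring
  have hcos : (‖a‖ : ℂ) = ‖z‖ * Complex.cos z.arg := by
    rw [← Complex.ofReal_cos, ← Complex.ofReal_mul, Complex.norm_mul_cos_arg]
  have hsin : (‖b‖ : ℂ) = ‖z‖ * Complex.sin z.arg := by
    rw [← Complex.ofReal_sin, ← Complex.ofReal_mul, Complex.norm_mul_sin_arg]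
  -- The common phase `g` and the phase `h` solve `h + g = arg a` and `g - h = arg b - π / 2`.
  set h : ℝ := (a.arg - b.arg + Real.pi / 2) / 2 with hh
  set g : ℝ := (a.arg + b.arg - Real.pi / 2) / 2 with hg
  refine ⟨‖z‖ * Complex.exp (g * Complex.I), z.arg, h, ?_, ?_, ?_⟩
  · calc a = ‖a‖ * Complex.exp (a.arg * Complex.I) := (Complex.norm_mul_exp_arg_mul_I a).symm
      _ = ‖a‖ * (Complex.exp (h * Complex.I) * Complex.exp (g * Complex.I)) := by
        rw [← Complex.exp_add]
        congr 2
        simp only [hh, hg]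
        push_cast
        ring
      _ = _ := by rw [hcos]; ring
  · calc b = ‖b‖ * Complex.exp (b.arg * Complex.I) := (Complex.norm_mul_exp_arg_mul_I b).symm
      _ = ‖b‖ * (Complex.exp (-(h * Complex.I)) * Complex.exp (g * Complex.I) *
            Complex.exp (Real.pi / 2 * Complex.I)) := by
        rw [← Complex.exp_add, ← Complex.exp_add]
        congr 2
        simp only [hh, hg]
        push_cast
        ring
      _ = _ := by rw [hsin, Complex.exp_pi_div_two_mul_I]; ring
  · rw [norm_mul, Complex.norm_exp_ofReal_mul_I, mul_one, Complex.norm_real, norm_norm, hzn]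

/-- The amplitudes `v` vanish on basis states with a nonzero bit outside `A`: the qubits outside `A`
are in the state `|0⟩`. -/
def SupportedOn (A : Finset (Fin n)) (v : BitString n → ℂ) : Prop :=
  ∀ y, v y ≠ 0 → ∀ i ∉ A, y i = 0

/-- Every state of the qubits in `A` is prepared from `|0^n⟩` by at most `s` gates. -/
def Preparable (G : SimpleGraph (Fin n)) (A : Finset (Fin n)) (s : ℕ) : Prop :=
  ∀ v : BitString n → ℂ, SupportedOn A v → ∑ y, ‖v y‖ ^ 2 = 1 →
    ∃ C : QCircuit n, QCircuit.UnderConstraint G C ∧ C.size ≤ s ∧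
      C.act (Pi.single 0 1) = v

/-- A sum over bit strings, grouped into pairs that differ in the bit `t`. -/
lemma sum_eq_sum_bit_zero (t : Fin n) (F : BitString n → ℝ) :
    ∑ y, F y = ∑ y, if y t = 0 then F (update y t 0) + F (update y t 1) else 0 := by
  have hflip : ∑ y, (if y t = 0 then F (update y t 1) else 0) =
      ∑ y, if y t = 0 then 0 else F y := by
    refine Finset.sum_nbij' (addAt t fun _ => 1) (addAt t fun _ => 1) (by simp) (by simp)
      (fun y _ => addAt_one_addAt_one t y) (fun y _ => addAt_one_addAt_one t y) fun y _ => ?_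
    obtain h | h : y t = 0 ∨ y t = 1 := by omega
    all_goals simp [addAt, h, fin_two_add_self]
  have hsplit (y : BitString n) : (if y t = 0 then F (update y t 0) + F (update y t 1) else 0) =
      (if y t = 0 then F y else 0) + if y t = 0 then F (update y t 1) else 0 := by
    split_ifs with h
    · conv_lhs => rw [← h, update_eq_self]
    · simp
  simp_rw [hsplit, Finset.sum_add_distrib]
  rw [hflip, ← Finset.sum_add_distrib]
  exact Finset.sum_congr rfl fun y _ => by split_ifs <;> simp

lemma preparable_empty (hn : 0 < n) : Preparable G ∅ 1 := by
  intro v hv hnorm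
  have hzero {y : BitString n} (hy : y ≠ 0) : v y = 0 := by
    by_contra h
    exact hy (funext fun i => hv y h i (by simp))
  have hv0 : ‖v 0‖ = 1 := by
    rw [Finset.sum_eq_single 0 (fun y _ hy => by simp [hzero hy]) (by simp)] at hnorm
    exact (pow_eq_one_iff_of_nonneg (norm_nonneg _) two_ne_zero).mp hnorm
  obtain ⟨C, hC, hsize, hact⟩ := implementable_diagonal G ⟨0, hn⟩ (d := fun _ => v 0)
    fun _ => hv0
  refine ⟨C, hC, hsize, ?_⟩
  rw [hact]
  funext y
  by_cases hy : y = 0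
  · simp [hy]
  · simp [hy, hzero hy]

/-- A state `v` of `A ∪ {t}` is the image of a state `r` of `A` under a Hadamard gate on `t`, a phase
operator, a Hadamard gate on `t` and another phase operator: for each value of the bits in `A`, this
sequence acts on `t` as a rotation followed by a relative phase, and the common phase of the two
amplitudes is part of `r`. -/
lemma Preparable.insert {A : Finset (Fin n)} {s : ℕ} {t : Fin n} (hA : Preparable G A s)
    (ht : Multiplexable G t A) :
    Preparable G (insert t A) (s + 14 * 2 ^ A.card) := by
  intro v hv hnorm
  choose R Θ H ha hb hR using exists_amplitude_angles
  set r : BitString n → ℂ := fun y =>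
    if y t = 0 then R (v (update y t 0)) (v (update y t 1)) else 0 with hr
  -- Clearing the bits outside `A ∪ {t}` makes the angles depend on the bits in `A` only.
  set π : BitString n → BitString n := fun y i => if i ∈ Insert.insert t A then y i else 0 with hπ
  have hπ_congr {x y : BitString n}
      (hxy : ∀ i ∈ (Insert.insert t (A : Set (Fin n))), x i = y i) : π x = π y := by
    funext i
    simp only [hπ]
    split_ifs with hi
    · exact hxy i (by simpa using hi)
    · rfl
  have hπ_update (y : BitString n) (b c : Fin 2) :
      update (π (update y t b)) t c = update (π y) t c := by
    funext i
    by_cases hi : i = t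
    · subst hi; simp
    · simp [hπ, hi]
  set phases : (ℂ → ℂ → ℝ) → BitString n → ℝ := fun T y =>
    (if y t = 0 then 1 else -1) * T (v (update (π y) t 0)) (v (update (π y) t 1)) with hphases
  have hphase (T : ℂ → ℂ → ℝ) :
      Implementable G (7 * 2 ^ A.card - 4 * A.card - 6) (phaseOp (phases T)) := by
    refine ht.phase _ ?_ ?_
    · intro x y hxy
      simp only [hphases]
      rw [hπ_congr hxy, hxy t (by simp)]
    · intro y
      simp only [hphases]
      rw [addAt, hπ_update, hπ_update]
      obtain h | h : y t = 0 ∨ y t = 1 := by omega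
      all_goals simp [h, fin_two_add_self]
  -- The norm identity forces `r` to vanish where `v` does.
  have hR0 : R 0 0 = 0 := by
    have := hR 0 0
    simpa using this
  have hrA : SupportedOn A r := by
    intro y hy i hi
    simp only [hr] at hy
    by_cases hyt : y t = 0
    · rw [if_pos hyt] at hy
      by_cases hit : i = t
      · exact hit ▸ hyt
      · have hi' : i ∉ Insert.insert t A := by simp [hit, hi]
        by_contra hyi
        have hvan (b : Fin 2) : v (update y t b) = 0 := by
          by_contra h
          exact hyi (by simpa [hit] using hv _ h i hi')
        exact hy (by rw [hvan, hvan, hR0])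
    · exact absurd (if_neg hyt) hy
  have hrnorm : ∑ y, ‖r y‖ ^ 2 = 1 := by
    rw [← hnorm, sum_eq_sum_bit_zero t fun y => ‖v y‖ ^ 2]
    refine Finset.sum_congr rfl fun y _ => ?_
    simp only [hr]
    split_ifs
    · exact hR _ _
    · simp
  obtain ⟨C, hC, hsize, hCr⟩ := hA r hrA hrnorm
  have hHad := implementable_hadamard G t
  obtain ⟨D, hD, hDsize, hDact⟩ := (hphase H).comp (hHad.comp ((hphase Θ).comp hHad))
  refine ⟨C ++ D, fun g hg => (List.mem_append.mp hg).elim (hC g) (hD g), ?_, ?_⟩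
  · have : A.card + 1 ≤ 2 ^ A.card := Nat.lt_two_pow_self
    simp only [QCircuit.size, List.length_append] at *
    omega
  · rw [QCircuit.act_append, hCr, hDact]
    funext y
    have hsqrt : (√2 : ℂ)⁻¹ * (√2 : ℂ)⁻¹ = 2⁻¹ := by
      rw [← mul_inv, ← Complex.ofReal_mul, Real.mul_self_sqrt (by norm_num)]
      norm_num
    have hr0 : r (update y t 0) = R (v (update y t 0)) (v (update y t 1)) := by simp [hr]
    simp only [comp_apply, phaseOp, update_idem, hphases, hπ_update, update_self]
    have hr1 : r (update y t 1) = 0 := by simp [hr]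
    rw [hr1, hr0]
    by_cases hy : ∃ i ∉ Insert.insert t A, y i ≠ 0
    · obtain ⟨i, hi, hyi⟩ := hy
      have hit : i ≠ t := fun e => hi (by simp [e])
      have hvan (b : Fin 2) : v (update y t b) = 0 := by
        by_contra h
        exact hyi (by simpa [hit] using hv _ h i hi)
      have hvy : v y = 0 := by simpa using hvan (y t)
      rw [hvan, hvan, hR0, hvy]
      simp
    · push Not at hy
      have hπy : π y = y := by
        funext i
        simp only [hπ]
        split_ifs with hi
        · rfl
        · exact (hy i hi).symm
      rw [hπy]
      set a := v (update y t 0) with ha'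
      set b := v (update y t 1) with hb'
      obtain h | h : y t = 0 ∨ y t = 1 := by omega
      · have hvy : v y = a := by rw [ha', ← h, update_eq_self]
        rw [hvy, h]
        conv_rhs => rw [ha a b, Complex.cos]
        push_cast
        simp
        linear_combination (Complex.exp (Θ a b * Complex.I) +
          Complex.exp (-(Θ a b * Complex.I))) * R a b * hsqrt
      · have hvy : v y = b := by rw [hb', ← h, update_eq_self]
        rw [hvy, h]
        conv_rhs => rw [hb a b, Complex.sin]
        push_cast
        simp
        linear_combination (Complex.exp (Θ a b * Complex.I) -
          Complex.exp (-(Θ a b * Complex.I))) * R a b * hsqrt +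
          (Complex.exp (Θ a b * Complex.I) - Complex.exp (-(Θ a b * Complex.I))) / 2 * R a b *
            Complex.I_sq

lemma preparable_univ (hn : 0 < n) (hG : G.Connected) :
    Preparable G Finset.univ (14 * 2 ^ n) := by
  have key : ∀ k ≤ n, ∃ A : Finset (Fin n), A.card = k ∧ EdgeConnected G A ∧
      Preparable G A (14 * 2 ^ k) := by
    intro k
    induction k with
    | zero =>
      refine fun _ => ⟨∅, rfl, fun B hB hne => ?_, fun v hv hnorm => ?_⟩
      · exact absurd (Finset.subset_empty.mp hB) hne.ne_empty
      · obtain ⟨C, hC, hsize, h⟩ := preparable_empty (G := G) hn v hv hnorm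
        exact ⟨C, hC, hsize.trans (by norm_num), h⟩
    | succ k ih =>
      intro hk
      obtain ⟨A, hcard, hA, hP⟩ := ih (by omega)
      obtain ⟨t, ht, hAt⟩ := hA.exists_insert hG fun e => by
        rw [e, Finset.card_univ, Fintype.card_fin] at hcard
        omega
      refine ⟨insert t A, by rw [Finset.card_insert_of_notMem ht, hcard], hAt, ?_⟩
      have := hP.insert (hAt.multiplexable ht)
      rw [hcard] at this
      rwa [pow_succ, mul_two, mul_add]
  obtain ⟨A, hcard, -, hP⟩ := key n le_rfl
  rwa [← Finset.card_eq_iff_eq_univ A |>.mp (by simpa using hcard)]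

end Preparation

/-! ### Counting parameters -/

section LowerBound

variable {n : ℕ}

lemma Gate.exists_entries_mem_adjoin (g : Gate n) : ∃ S : Finset ℂ, S.card ≤ 4 ∧
    ∀ x y, g.matrix x y ∈ Algebra.adjoin ℚ (S : Set ℂ) := by
  classical
  cases g with
  | single q U =>
    refine ⟨Finset.univ.image fun p : Fin 2 × Fin 2 => (U : Matrix (Fin 2) (Fin 2) ℂ) p.1 p.2,
      Finset.card_image_le.trans (by simp), fun x y => ?_⟩
    simp only [Gate.matrix, Matrix.of_apply]
    split_ifs
    · exact Algebra.subset_adjoin (Finset.mem_image_of_mem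
        (fun p : Fin 2 × Fin 2 => (U : Matrix (Fin 2) (Fin 2) ℂ) p.1 p.2) (Finset.mem_univ (x q, y q)))
    · exact zero_mem _
  | cnot c t h =>
    refine ⟨∅, by simp, fun x y => ?_⟩
    simp only [Gate.matrix, Matrix.of_apply]
    split_ifs
    · exact one_mem _
    · exact zero_mem _

lemma QCircuit.exists_entries_mem_adjoin (C : QCircuit n) : ∃ S : Finset ℂ, S.card ≤ 4 * C.size ∧
    ∀ x y, C.matrix x y ∈ Algebra.adjoin ℚ (S : Set ℂ) := by
  classical
  induction C with
  | nil =>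
    refine ⟨∅, by simp, fun x y => ?_⟩
    simp only [QCircuit.matrix, Matrix.one_apply]
    split_ifs
    · exact one_mem _
    · exact zero_mem _
  | cons g C ih =>
    obtain ⟨S, hS, hCS⟩ := ih
    obtain ⟨S', hS', hgS'⟩ := g.exists_entries_mem_adjoin
    refine ⟨S ∪ S', (Finset.card_union_le _ _).trans ?_, fun x y => ?_⟩
    · simp only [QCircuit.size, List.length_cons] at *
      omega
    · rw [QCircuit.matrix, Matrix.mul_apply]
      refine sum_mem fun z _ => mul_mem ?_ ?_
      · exact Algebra.adjoin_mono (by simp) (hCS x z)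
      · exact Algebra.adjoin_mono (by simp) (hgS' z y)

/-- An algebraically independent family in the `ℚ`-algebra generated by a finite set is no larger than
this set: it lifts to the polynomial ring, whose transcendence degree is known. -/
lemma AlgebraicIndependent.card_le_of_mem_adjoin {ι : Type} [Fintype ι] {w : ι → ℂ}
    (hw : AlgebraicIndependent ℚ w) (S : Finset ℂ)
    (hS : ∀ i, w i ∈ Algebra.adjoin ℚ (S : Set ℂ)) : Fintype.card ι ≤ S.card := by
  have hp (i : ι) : ∃ p : MvPolynomial S ℚ, MvPolynomial.aeval (Subtype.val : S → ℂ) p = w i := by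
    have := hS i
    rw [← Subtype.range_coe (s := (S : Set ℂ)), Algebra.adjoin_range_eq_range_aeval] at this
    exact this
  choose p hp using hp
  have hpw : AlgebraicIndependent ℚ p := by
    refine AlgebraicIndependent.of_comp (MvPolynomial.aeval (Subtype.val : S → ℂ)) ?_
    convert hw using 1
    exact funext hp
  simpa using hpw.cardinalMk_le_trdeg.trans_eq MvPolynomial.trdeg_of_isDomain

lemma exists_algebraicIndependent (ι : Type) [Fintype ι] :
    ∃ w : ι → ℂ, AlgebraicIndependent ℚ w := by
  obtain ⟨κ, x, hx⟩ := exists_isTranscendenceBasis' ℚ ℂ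
  have hcard := IsAlgClosed.cardinal_eq_cardinal_transcendence_basis_of_aleph0_lt' x hx
    (by simp) (by simpa using Cardinal.aleph0_lt_continuum)
  have : Infinite κ := by
    rw [Cardinal.infinite_iff, ← hcard]
    simpa using Cardinal.aleph0_le_continuum
  let e : ι ↪ κ := (Fintype.equivFin ι).toEmbedding.trans
    (Fin.valEmbedding.trans (Infinite.natEmbedding κ))
  exact ⟨x ∘ e, hx.1.comp e e.injective⟩

/-- The amplitudes of the state are those of an algebraically independent family after
normalisation. Together with the norm, the entries of the gates generate this family. -/
lemma exists_state_size_ge (n : ℕ) : ∃ v : StateVector n, ‖v‖ = 1 ∧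
    ∀ C : QCircuit n, C.Prepares v → 2 ^ n ≤ 4 * C.size + 1 := by
  classical
  obtain ⟨w, hw⟩ := exists_algebraicIndependent (BitString n)
  set u : StateVector n := WithLp.toLp 2 w with hu
  have hu0 : ‖u‖ ≠ 0 := by
    rw [norm_ne_zero_iff]
    intro h
    exact hw.ne_zero 0 (congrFun (congrArg WithLp.ofLp h) 0)
  refine ⟨(‖u‖ : ℂ)⁻¹ • u, ?_, fun C hC => ?_⟩
  · rw [norm_smul, norm_inv, Complex.norm_real, norm_norm, inv_mul_cancel₀ hu0]
  · obtain ⟨S, hS, hCS⟩ := C.exists_entries_mem_adjoin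
    have hwC (x : BitString n) : w x = ‖u‖ * C.matrix x 0 := by
      have h : C.act (Pi.single 0 1) x = (‖u‖ : ℂ)⁻¹ * w x :=
        congrFun (congrArg WithLp.ofLp hC) x
      rw [QCircuit.act, Matrix.mulVec_single_one, Matrix.col_apply] at h
      rw [h, mul_inv_cancel_left₀ (by exact_mod_cast hu0)]
    have hcard := hw.card_le_of_mem_adjoin (insert (‖u‖ : ℂ) S) fun x => by
      rw [hwC]
      refine mul_mem (Algebra.subset_adjoin (by simp)) ?_
      exact Algebra.adjoin_mono (by simp) (hCS x 0)
    have := hcard.trans (Finset.card_insert_le _ _)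
    simp at this
    omega

end LowerBound

/-! ### The two bounds -/

theorem mainTheorem4 :
    (∃ K : ℝ, 0 < K ∧
      ∀ n : ℕ, 1 ≤ n → ∀ G : SimpleGraph (Fin n), G.Connected →
        ∀ v : StateVector n, ‖v‖ = 1 →
          ∃ C : QCircuit n, QCircuit.UnderConstraint G C ∧ QCircuit.Prepares C v ∧
            (QCircuit.size C : ℝ) ≤ K * 2 ^ n) ∧
    (∃ κ : ℝ, 0 < κ ∧
      ∀ n : ℕ, 1 ≤ n →
        ∃ v : StateVector n, ‖v‖ = 1 ∧
          ∀ (G : SimpleGraph (Fin n)) (C : QCircuit n),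
            QCircuit.UnderConstraint G C → QCircuit.Prepares C v →
              κ * 2 ^ n ≤ (QCircuit.size C : ℝ)) := by
  refine ⟨⟨14, by norm_num, fun n hn G hG v hv => ?_⟩, ⟨1 / 8, by norm_num, fun n hn => ?_⟩⟩
  · have hnorm : ∑ y, ‖v y‖ ^ 2 = 1 := by
      rw [← EuclideanSpace.norm_sq_eq, hv, one_pow]
    obtain ⟨C, hC, hsize, hact⟩ :=
      preparable_univ hn hG v.ofLp (fun _ _ i hi => absurd (Finset.mem_univ i) hi) hnorm
    refine ⟨C, hC, ?_, by exact_mod_cast hsize⟩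
    exact (WithLp.ofLp_injective 2) hact
  · obtain ⟨v, hv, hC⟩ := exists_state_size_ge n
    refine ⟨v, hv, fun G C _ hp => ?_⟩
    have h₁ : (2 : ℝ) ^ n ≤ 4 * C.size + 1 := by exact_mod_cast hC C hp
    have h₂ : (2 : ℝ) ^ 1 ≤ 2 ^ n := pow_le_pow_right₀ (by norm_num) hn
    linarith
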